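/- Let $S\subset\mathbb R^2$ be a compact convex set with non-empty interior whose boundary $\partial S$ is a $C^2$ curve (a simple closed curve with a regular $C^2$ parametrization). Let the visibility domain $V_S$ be the set of all pairs $(p,v)$, where $p\in\mathbb R^2\setminus\operatorname{int}(S)$ and $v$ is a unit vector, such that the ray from $p$ in the direction $v$ meets $S$. The bouncing outer billiard map $F\colon V_S\to V_S$, $F(p,v)=(p',v')$, is defined as follows. Let $w$ be the first point of $S$ on the ray from $p$ in the direction $v$; let $R'$ be the ray starting at $w$ whose direction $r$ is the reflection of $v$ in the tangent line to $\partial S$ at $w$ (the angle of incidence equals the angle of reflection); let $p'\in R'$ be the point with $\|p'-w\|=\|p-w\|$; and let $v'$ be the reflection of $u=-r$ (the direction from $p'$ to $w$) across the bisector of the angle formed by the two rays from $p'$ that are tangent to $S$ (when $p'\in\partial S$, these rays are opposite and the bisector is the normal line to $\partial S$ at $p'$). Then $F$ does map $V_S$ into itself, and the restriction to $V_S$ of the measure $dA\otimes d\theta$, where $dA$ is the Lebesgue measure on $\mathbb R^2$ and $d\theta$ is the Lebesgue measure on the circle of unit vectors, is an infinite measure that is invariant under $F$. -/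

import Mathlib

open MeasureTheory Set

noncomputable section

/-- The Euclidean plane `ℝ²`. -/
abbrev Plane : Type := EuclideanSpace ℝ (Fin 2)

/-- The circle of unit vectors of the plane. -/
abbrev UnitVec : Type := Metric.sphere (0 : Plane) 1

/-- `Γ` is a simple closed regular curve of class `C²` in the plane: it is traced out once per
period by a periodic `C²` parametrization with nowhere vanishing velocity. -/
def IsSimpleClosedC2Curve (Γ : Set Plane) : Prop :=
  ∃ (γ : ℝ → Plane) (L : ℝ), 0 < L ∧ ContDiff ℝ 2 γ ∧ Function.Periodic γ L ∧
    InjOn γ (Ico 0 L) ∧ (∀ s, deriv γ s ≠ 0) ∧ range γ = Γ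

/-- The unit vector `(cos θ, sin θ)`. -/
def unitVec (θ : ℝ) : UnitVec :=
  ⟨!₂[Real.cos θ, Real.sin θ], by
    simp [EuclideanSpace.norm_eq]⟩

/-- The Lebesgue measure `dθ` on the circle of unit vectors (of total mass `2π`). -/
def circleMeasure : Measure UnitVec :=
  (volume.restrict (Ioc (0 : ℝ) (2 * Real.pi))).map unitVec

/-- The measure `dA ⊗ dθ` on the unit tangent bundle of the plane. -/
def phaseMeasure : Measure (Plane × UnitVec) :=
  (volume : Measure Plane).prod circleMeasure

/-- The visibility domain `V_S`: pairs `(p, v)`, with `p` not interior to `S`, such that the ray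
from `p` in the direction of the unit vector `v` meets `S`. -/
def visibilityDomain (S : Set Plane) : Set (Plane × UnitVec) :=
  {z | z.1 ∉ interior S ∧ ∃ t : ℝ, 0 ≤ t ∧ z.1 + t • (z.2 : Plane) ∈ S}

/-- The restriction of `dA ⊗ dθ` to `V_S`, as a measure on `V_S`. -/
def visibilityMeasure (S : Set Plane) : Measure (visibilityDomain S) :=
  phaseMeasure.comap Subtype.val

/-- The bounce point `w`: the first point of `S` on the ray from `p` in the direction `v`. -/
def bouncePoint (S : Set Plane) (p v : Plane) : Plane :=
  p + sInf {t : ℝ | 0 ≤ t ∧ p + t • v ∈ S} • v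

/-- The direction of the tangent line at the boundary point `w` of a convex set `S`, as a linear
subspace: the vectors orthogonal to all outward normals of `S` at `w`. (Where the boundary is
`C¹` the outward normals form a single ray, so that this is a line.) -/
def tangentLine (S : Set Plane) (w : Plane) : Submodule ℝ Plane :=
  (Submodule.span ℝ {n : Plane | ∀ x ∈ S, inner ℝ n (x - w) ≤ 0})ᗮ

/-- The ray from `p` in the direction of the unit vector `d` is tangent to the convex body `S`:
it meets `S`, and its line does not enter the interior of `S`. -/
def IsTangentDir (S : Set Plane) (p d : Plane) : Prop :=
  ‖d‖ = 1 ∧ (∃ t : ℝ, 0 ≤ t ∧ p + t • d ∈ S) ∧ ∀ t : ℝ, p + t • d ∉ interior S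

/-- The direction of the bisector of the angle between the two rays from `p` tangent to `S`, as a
linear subspace: the vectors that make equal angles with the directions of these rays. (If `p` is
a boundary point, these directions are opposite and the bisector is the normal line.) -/
def bisectorLine (S : Set Plane) (p : Plane) : Submodule ℝ Plane where
  carrier := {x | ∀ h k : Plane, IsTangentDir S p h → IsTangentDir S p k →
    inner ℝ h x = inner ℝ k x}
  add_mem' := by
    intro x y hx hy h k hh hk
    rw [inner_add_right, inner_add_right, hx h k hh hk, hy h k hh hk]
  zero_mem' := by
    intro h k _ _
    rw [inner_zero_right, inner_zero_right]
  smul_mem' := by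
    intro c x hx h k hh hk
    rw [inner_smul_right, inner_smul_right, hx h k hh hk]

/-- The direction of the ray reflected at `w`: angle of incidence equals angle of reflection. -/
def reflectedDir (S : Set Plane) (p v : Plane) : Plane :=
  (tangentLine S (bouncePoint S p v)).reflection v

/-- The point `p'` on the reflected ray with `‖p' - w‖ = ‖p - w‖`. -/
def nextPoint (S : Set Plane) (p v : Plane) : Plane :=
  bouncePoint S p v + dist p (bouncePoint S p v) • reflectedDir S p v

/-- The direction `v'`: the reflection of the direction `u` from `p'` back to `w` (opposite to the
reflected ray) across the bisector of the angle between the two rays from `p'` tangent to `S`. -/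
def nextDir (S : Set Plane) (p v : Plane) : Plane :=
  (bisectorLine S (nextPoint S p v)).reflection (-reflectedDir S p v)

theorem norm_nextDir (S : Set Plane) (p v : Plane) : ‖nextDir S p v‖ = ‖v‖ := by
  simp only [nextDir, reflectedDir, LinearIsometryEquiv.norm_map, norm_neg]

/-- The bouncing outer billiard map `F_S`. It is meaningful on the visibility domain of `S`. -/
def bouncingOuterBilliard (S : Set Plane) (z : Plane × UnitVec) : Plane × UnitVec :=
  (nextPoint S z.1 z.2, ⟨nextDir S z.1 z.2, by
    rw [mem_sphere_zero_iff_norm, norm_nextDir]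
    exact mem_sphere_zero_iff_norm.1 z.2.2⟩)

end

/-!
Let `F = bisector ∘ bounce`, where `bounce (p, v) = (p', u)`. Describe a ray by the boundary point
`γ s` at which it arrives, the time `t` of arrival and its direction `v`, so that `p = γ s - t v`.
In these coordinates `dA ⊗ dθ` has density `|ω (γ' s, v)|` with respect to `ds dt dθ`, while the
bounce fixes `s` and `t` and replaces `v` by its reflection in the normal line at `γ s`. This
reflection is an isometry of the circle which does not change `ω (γ' s, v)`, hence the bounce
preserves the measure. The second factor fixes the base point `p'` and acts on directions by a
reflection which exchanges the two tangent rays, so it preserves the cone of directions visible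
from `p'` and the measure `dθ`.
-/

open Function
open scoped EuclideanSpace RealInnerProductSpace

section NormalReflection

variable {E : Type*} [NormedAddCommGroup E] [InnerProductSpace ℝ E]

/-- The reflection in the hyperplane orthogonal to `g`, which is the identity if `g = 0`. -/
noncomputable def normalReflection (g : E) : E ≃ₗᵢ[ℝ] E := (ℝ ∙ g)ᗮ.reflection

theorem normalReflection_apply (g v : E) :
    normalReflection g v = v - (2 * (⟪g, v⟫ / ‖g‖ ^ 2)) • g := by
  rw [normalReflection, Submodule.reflection_orthogonal_apply, Submodule.reflection_singleton_apply]
  simp [two_smul, two_mul, add_smul]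

theorem normalReflection_normalReflection (g v : E) :
    normalReflection g (normalReflection g v) = v :=
  Submodule.reflection_reflection _ v

theorem normalReflection_sub_left {h k : E} (hhk : ‖h‖ = ‖k‖) : normalReflection (h - k) h = k :=
  Submodule.reflection_sub hhk

theorem normalReflection_sub_right {h k : E} (hhk : ‖h‖ = ‖k‖) :
    normalReflection (h - k) k = h :=
  (congrArg _ (normalReflection_sub_left hhk)).symm.trans (normalReflection_normalReflection _ h)

theorem reflection_span_singleton_eq_neg_normalReflection (g v : E) :
    (ℝ ∙ g).reflection v = -normalReflection g v := by
  rw [normalReflection, Submodule.reflection_orthogonal_apply, neg_neg]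

theorem measurable_normalReflection [MeasurableSpace E] [BorelSpace E]
    [SecondCountableTopology E] : Measurable fun z : E × E => normalReflection z.1 z.2 := by
  simp only [normalReflection_apply]
  fun_prop

end NormalReflection

section AreaForm

variable {E : Type*} [NormedAddCommGroup E] [InnerProductSpace ℝ E]
  [Fact (Module.finrank ℝ E = 2)] (o : Orientation ℝ E (Fin 2))

local notation "ω" => o.areaForm

theorem norm_sq_smul_eq_inner_smul_add_areaForm_smul (a y : E) :
    ‖a‖ ^ 2 • y = ⟪a, y⟫ • a + ω a y • o.rightAngleRotation a := by
  refine ext_inner_right ℝ fun z => ?_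
  simp only [inner_add_left, real_inner_smul_left, o.inner_rightAngleRotation_left]
  exact (o.inner_mul_inner_add_areaForm_mul_areaForm a y z).symm

theorem areaForm_smul_eq_areaForm_smul_add (a b d : E) :
    ω a b • d = ω d b • a + ω a d • b := by
  rcases eq_or_ne a 0 with rfl | ha
  · simp
  have hcoeff := o.inner_mul_areaForm_sub a d b
  refine smul_right_injective E (pow_ne_zero 2 (norm_ne_zero_iff.2 ha)) ?_
  simp only [smul_add, smul_comm (‖a‖ ^ 2), norm_sq_smul_eq_inner_smul_add_areaForm_smul o a d,
    norm_sq_smul_eq_inner_smul_add_areaForm_smul o a b]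
  match_scalars
  · linear_combination hcoeff
  · ring

variable {o}

theorem exists_eq_smul_of_areaForm_eq_zero {x y : E} (hx : x ≠ 0) (hxy : ω x y = 0) :
    ∃ c : ℝ, y = c • x := by
  have hy := norm_sq_smul_eq_inner_smul_add_areaForm_smul o x y
  rw [hxy, zero_smul, add_zero] at hy
  refine ⟨(‖x‖ ^ 2)⁻¹ * ⟪x, y⟫, ?_⟩
  rw [mul_smul, ← hy, inv_smul_smul₀ (pow_ne_zero 2 (norm_ne_zero_iff.2 hx))]

theorem areaForm_normalReflection (g v : E) : ω g (normalReflection g v) = ω g v := by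
  simp [normalReflection_apply]

end AreaForm

section CircleMeasure

instance : Fact (0 < 2 * Real.pi) := ⟨Real.two_pi_pos⟩

theorem continuous_unitVec : Continuous unitVec := by
  refine Continuous.subtype_mk ((PiLp.continuous_toLp 2 _).comp (continuous_pi fun i => ?_)) _
  fin_cases i
  · exact Real.continuous_cos
  · exact Real.continuous_sin

theorem periodic_unitVec : Function.Periodic unitVec (2 * Real.pi) := fun θ => by
  simp [unitVec]

theorem measurePreserving_lift_unitVec :
    MeasurePreserving periodic_unitVec.lift (volume : Measure (AddCircle (2 * Real.pi)))
      circleMeasure := by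
  have hlift : Continuous periodic_unitVec.lift := continuous_coinduced_dom.2 continuous_unitVec
  have hmk := AddCircle.measurePreserving_mk (2 * Real.pi) 0
  refine ⟨hlift.measurable, ?_⟩
  rw [← hmk.map_eq, Measure.map_map hlift.measurable hmk.measurable, zero_add]
  rfl

instance : IsFiniteMeasure circleMeasure := by
  unfold circleMeasure; infer_instance

instance : NeZero circleMeasure := by
  refine ⟨fun hzero => ?_⟩
  rw [circleMeasure, Measure.map_eq_zero_iff continuous_unitVec.aemeasurable,
    Measure.restrict_eq_zero, Real.volume_Ioc] at hzero
  simp [Real.pi_pos.not_ge] at hzero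

instance : SFinite phaseMeasure := by
  unfold phaseMeasure; infer_instance

theorem surjective_unitVec : Surjective unitVec := by
  intro v
  have hnorm : ‖(⟨(v : Plane) 0, (v : Plane) 1⟩ : ℂ)‖ = 1 := by
    have hv : ‖(v : Plane)‖ ^ 2 = 1 := by rw [mem_sphere_zero_iff_norm.1 v.2, one_pow]
    rw [EuclideanSpace.norm_sq_eq, Fin.sum_univ_two] at hv
    rw [← sq_eq_sq₀ (norm_nonneg _) zero_le_one, Complex.sq_norm, Complex.normSq_mk, one_pow]
    simpa [sq] using hv
  refine ⟨Complex.arg ⟨(v : Plane) 0, (v : Plane) 1⟩, Subtype.ext ?_⟩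
  ext i
  fin_cases i
  · simpa [unitVec, hnorm] using Complex.norm_mul_cos_arg ⟨(v : Plane) 0, (v : Plane) 1⟩
  · simpa [unitVec, hnorm] using Complex.norm_mul_sin_arg ⟨(v : Plane) 0, (v : Plane) 1⟩

/-- The action of a linear isometry on the circle of unit vectors. -/
noncomputable def unitMap (f : Plane ≃ₗᵢ[ℝ] Plane) (v : UnitVec) : UnitVec :=
  ⟨f v, by rw [mem_sphere_zero_iff_norm, f.norm_map, mem_sphere_zero_iff_norm.1 v.2]⟩

theorem coe_unitMap (f : Plane ≃ₗᵢ[ℝ] Plane) (v : UnitVec) : (unitMap f v : Plane) = f v :=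
  rfl

theorem inner_unitVec (a b : ℝ) : ⟪(unitVec a : Plane), unitVec b⟫ = Real.cos (a - b) := by
  simp [unitVec, PiLp.inner_apply, Fin.sum_univ_two, Real.cos_sub, mul_comm]

theorem unitVec_eq_cos_smul_add_sin_smul (θ : ℝ) :
    (unitVec θ : Plane) =
      Real.cos θ • (unitVec 0 : Plane) + Real.sin θ • (unitVec (Real.pi / 2) : Plane) := by
  ext i
  fin_cases i <;> simp [unitVec]

/-- The image of the orthonormal frame `e₀, e_{π/2}` under `f` is a frame `e_a, e_{a ∓ π/2}`. -/
theorem exists_unitMap_unitVec (f : Plane ≃ₗᵢ[ℝ] Plane) :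
    ∃ a ε : ℝ, (ε = 1 ∨ ε = -1) ∧ ∀ θ, unitMap f (unitVec θ) = unitVec (a - ε * θ) := by
  obtain ⟨a, ha⟩ := surjective_unitVec (unitMap f (unitVec 0))
  obtain ⟨b, hb⟩ := surjective_unitVec (unitMap f (unitVec (Real.pi / 2)))
  have horth : Real.cos (a - b) = 0 := by
    rw [← inner_unitVec, ha, hb]
    exact (f.inner_map_map _ _).trans (by rw [inner_unitVec]; simp)
  have hsin : Real.sin (a - b) = 1 ∨ Real.sin (a - b) = -1 := by
    rw [← sq_eq_one_iff, Real.sin_sq, horth]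
    norm_num
  refine ⟨a, Real.sin (a - b), hsin, fun θ => Subtype.ext ?_⟩
  have hmap : (unitMap f (unitVec θ) : Plane) =
      Real.cos θ • (unitVec a : Plane) + Real.sin θ • (unitVec b : Plane) := by
    rw [ha, hb]
    simp only [unitMap, unitVec_eq_cos_smul_add_sin_smul θ, map_add, map_smul]
  have hcosb : Real.cos b = Real.sin (a - b) * Real.sin a := by
    simpa [horth, mul_comm] using Real.cos_sub a (a - b)
  have hsinb : Real.sin b = -(Real.sin (a - b) * Real.cos a) := by
    simpa [horth, mul_comm] using Real.sin_sub a (a - b)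
  rw [hmap]
  ext i
  rcases hsin with hsin | hsin <;> rw [hsin] at hcosb hsinb ⊢ <;> fin_cases i <;>
    simp [unitVec, hcosb, hsinb, Real.cos_sub, Real.sin_sub, Real.cos_add, Real.sin_add] <;> ring

theorem continuous_unitMap (f : Plane ≃ₗᵢ[ℝ] Plane) : Continuous (unitMap f) :=
  (f.continuous.comp continuous_subtype_val).subtype_mk _

theorem measurePreserving_unitMap (f : Plane ≃ₗᵢ[ℝ] Plane) :
    MeasurePreserving (unitMap f) circleMeasure circleMeasure := by
  obtain ⟨a, ε, hε, hf⟩ := exists_unitMap_unitVec f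
  have hmeas := (continuous_unitMap f).measurable
  rcases hε with rfl | rfl
  · refine measurePreserving_lift_unitVec.of_semiconj
      (Measure.measurePreserving_sub_left volume (a : AddCircle (2 * Real.pi))) ?_ hmeas
    rintro ⟨θ⟩
    exact (congrArg unitVec (by ring)).trans (hf θ).symm
  · refine measurePreserving_lift_unitVec.of_semiconj
      (measurePreserving_add_left volume (a : AddCircle (2 * Real.pi))) ?_ hmeas
    rintro ⟨θ⟩
    exact (congrArg unitVec (by ring)).trans (hf θ).symm

end CircleMeasure

section Rays

variable {E : Type*} [AddCommGroup E] [Module ℝ E] {S : Set E} {p d : E}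

theorem exists_pos_smul_mem_of_notMem (hp : p ∉ S) (hmeets : ∃ t : ℝ, 0 ≤ t ∧ p + t • d ∈ S) :
    ∃ t : ℝ, 0 < t ∧ p + t • d ∈ S := by
  obtain ⟨t, ht, hmem⟩ := hmeets
  refine ⟨t, ht.lt_of_ne' ?_, hmem⟩
  rintro rfl
  exact hp (by simpa using hmem)

theorem mem_of_meets_opposite_rays (hS : Convex ℝ S) (hd : ∃ t : ℝ, 0 ≤ t ∧ p + t • d ∈ S)
    (hneg : ∃ t : ℝ, 0 ≤ t ∧ p + t • -d ∈ S) : p ∈ S := by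
  by_contra hp
  obtain ⟨s, hs, hsS⟩ := exists_pos_smul_mem_of_notMem hp hd
  obtain ⟨t, ht, htS⟩ := exists_pos_smul_mem_of_notMem hp hneg
  refine hp ?_
  convert! hS hsS htS (a := t / (s + t)) (b := s / (s + t)) (by positivity) (by positivity)
    (by field_simp; ring) using 1
  match_scalars <;> field_simp <;> ring

theorem meets_smul_add_smul {h k : E} (hS : Convex ℝ S) (hh : ∃ t : ℝ, 0 < t ∧ p + t • h ∈ S)
    (hk : ∃ t : ℝ, 0 < t ∧ p + t • k ∈ S) {a b : ℝ} (ha : 0 ≤ a) (hb : 0 ≤ b) (hab : 0 < a + b) :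
    ∃ t : ℝ, 0 ≤ t ∧ p + t • (a • h + b • k) ∈ S := by
  obtain ⟨s, hs, hsS⟩ := hh
  obtain ⟨t, ht, htS⟩ := hk
  have hden : 0 < a * t + b * s := by
    rcases ha.eq_or_lt with rfl | ha
    · rw [zero_add] at hab; positivity
    · positivity
  refine ⟨s * t / (a * t + b * s), by positivity, ?_⟩
  convert! hS hsS htS (a := a * t / (a * t + b * s)) (b := b * s / (a * t + b * s))
    (by positivity) (by positivity) (by field_simp) using 1
  match_scalars <;> field_simp

end Rays

section ConvexBodies

theorem le_of_forall_mem_interior_le {E : Type*} [NormedAddCommGroup E] [NormedSpace ℝ E]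
    {S : Set E} (hS : Convex ℝ S) (hint : (interior S).Nonempty) {g : E → ℝ} (hg : Continuous g)
    {c : ℝ} (hc : ∀ x ∈ interior S, c ≤ g x) : ∀ x ∈ S, c ≤ g x := by
  intro x hx
  have hx' : x ∈ closure (interior S) := by
    rw [hS.closure_interior_eq_closure_of_nonempty_interior hint]
    exact subset_closure hx
  exact closure_minimal hc (isClosed_Ici.preimage hg) hx'

variable {E : Type*} [NormedAddCommGroup E] [InnerProductSpace ℝ E]

/-- `n` is an outward normal vector, possibly zero, of the set `S` at the point `p`. -/
def IsOutwardNormal (S : Set E) (p n : E) : Prop := ∀ x ∈ S, ⟪n, x - p⟫ ≤ 0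

/-- A smooth convex body: a compact convex set with non-empty interior that has a unique outward
normal direction at each boundary point. -/
structure IsSmoothConvexBody (S : Set E) : Prop where
  isCompact : IsCompact S
  convex : Convex ℝ S
  nonempty_interior : (interior S).Nonempty
  sameRay : ∀ p ∈ frontier S, ∀ m n, IsOutwardNormal S p m → IsOutwardNormal S p n → SameRay ℝ m n

theorem inner_pos_of_mem_interior {S : Set E} {n p x : E} (hn : n ≠ 0)
    (hS : ∀ y ∈ S, 0 ≤ ⟪n, y - p⟫) (hx : x ∈ interior S) : 0 < ⟪n, x - p⟫ := by
  have hopen : IsOpenMap (innerSL ℝ n) :=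
    (innerSL ℝ n).isOpenMap_of_ne_zero <| by
      rwa [Ne, ← norm_eq_zero, innerSL_apply_norm, norm_eq_zero]
  have hmaps : MapsTo (innerSL ℝ n) S (Ici ⟪n, p⟫) := fun y hy => by
    simpa [inner_sub_right] using hS y hy
  have hpos := hopen.mapsTo_interior hmaps hx
  rw [interior_Ici] at hpos
  simpa [inner_sub_right] using hpos

variable [Fact (Module.finrank ℝ E = 2)] {o : Orientation ℝ E (Fin 2)} {S : Set E} {p d : E}

local notation "ω" => o.areaForm
local notation "J" => o.rightAngleRotation

theorem continuous_areaForm : Continuous fun z : E × E => ω z.1 z.2 := by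
  simp only [← o.inner_rightAngleRotation_left]
  fun_prop

theorem areaForm_neg_orientation_apply (x y : E) : (-o).areaForm x y = ω y x := by
  rw [o.areaForm_swap y x, o.areaForm_neg_orientation, LinearMap.neg_apply, LinearMap.neg_apply]

theorem areaForm_pos_of_mem_interior {x : E} (hd : d ≠ 0) (hS : ∀ y ∈ S, 0 ≤ ω d (y - p))
    (hx : x ∈ interior S) : 0 < ω d (x - p) := by
  simp only [← o.inner_rightAngleRotation_left] at hS ⊢
  exact inner_pos_of_mem_interior (by simpa using hd) hS hx

theorem areaForm_nonneg_or_nonpos_of_line_disjoint_interior (hS : Convex ℝ S)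
    (hint : (interior S).Nonempty) (hd : d ≠ 0) (hline : ∀ t : ℝ, p + t • d ∉ interior S) :
    (∀ x ∈ S, 0 ≤ ω d (x - p)) ∨ ∀ x ∈ S, 0 ≤ (-o).areaForm d (x - p) := by
  have hω : Continuous fun x => ω d (x - p) :=
    continuous_areaForm.comp (continuous_const.prodMk (continuous_id.sub continuous_const))
  have hsign : (∀ x ∈ interior S, 0 ≤ ω d (x - p)) ∨ ∀ x ∈ interior S, 0 ≤ -ω d (x - p) := by
    by_contra! hcon
    obtain ⟨⟨x, hx, hx'⟩, y, hy, hy'⟩ := hcon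
    obtain ⟨z, hz, hz0⟩ := hS.interior.isPreconnected.intermediate_value hx hy hω.continuousOn
      ⟨hx'.le, (neg_neg_iff_pos.1 hy').le⟩
    obtain ⟨c, hc⟩ := exists_eq_smul_of_areaForm_eq_zero hd hz0
    exact hline c (by rwa [← hc, add_sub_cancel])
  simp only [areaForm_neg_orientation_apply, o.areaForm_swap _ d]
  exact hsign.imp (le_of_forall_mem_interior_le hS hint hω)
    (le_of_forall_mem_interior_le hS hint hω.neg)

theorem exists_supporting_direction (hS : Convex ℝ S) (hint : (interior S).Nonempty)
    (hp : p ∉ interior S) : ∃ d : E, d ≠ 0 ∧ ∀ x ∈ S, 0 ≤ ω d (x - p) := by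
  have := FiniteDimensional.of_fact_finrank_eq_two (K := ℝ) (V := E)
  obtain ⟨f, hf0, hf⟩ := geometric_hahn_banach_of_nonempty_interior_point hS hp hint
  refine ⟨J ((InnerProductSpace.toDual ℝ E).symm f), by simpa using hf0, fun x hx => ?_⟩
  rw [o.areaForm_rightAngleRotation_left, InnerProductSpace.toDual_symm_apply, map_sub]
  linarith [hf x hx]

theorem exists_extreme_direction (hS : IsCompact S) (hconv : Convex ℝ S) (hne : S.Nonempty)
    (hp : p ∉ S) : ∃ a ∈ S, ∀ x ∈ S, 0 ≤ ω (a - p) (x - p) := by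
  have := FiniteDimensional.of_fact_finrank_eq_two (K := ℝ) (V := E)
  obtain ⟨f, u, hfp, hfu⟩ := geometric_hahn_banach_point_closed hconv hS.isClosed hp
  obtain ⟨n, rfl⟩ := (InnerProductSpace.toDual ℝ E).surjective f
  have hpos : ∀ x ∈ S, 0 < ⟪n, x - p⟫ := fun x hx => by
    rw [inner_sub_right]
    exact sub_pos.2 (hfp.trans (hfu x hx))
  obtain ⟨b, hb⟩ := hne
  have hn : n ≠ 0 := by
    rintro rfl
    simpa using hpos b hb
  have hslope : ContinuousOn (fun x => ω n (x - p) / ⟪n, x - p⟫) S := by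
    simp only [← o.inner_rightAngleRotation_left]
    exact ContinuousOn.div (by fun_prop) (by fun_prop) fun x hx => (hpos x hx).ne'
  obtain ⟨a, ha, hmin⟩ := hS.exists_isMinOn ⟨b, hb⟩ hslope
  refine ⟨a, ha, fun x hx => ?_⟩
  have hax := hmin hx
  rw [mem_ofPred_eq, div_le_div_iff₀ (hpos a ha) (hpos x hx)] at hax
  refine nonneg_of_mul_nonneg_right (a := ‖n‖ ^ 2) ?_ (by positivity)
  rw [← o.inner_mul_areaForm_sub n]
  linarith

end ConvexBodies

section Tangents

variable {E : Type*} [NormedAddCommGroup E] [InnerProductSpace ℝ E]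
  [Fact (Module.finrank ℝ E = 2)] {o : Orientation ℝ E (Fin 2)} {S : Set E} {p d : E}

local notation "ω" => o.areaForm
local notation "J" => o.rightAngleRotation

/-- `d` is the direction of the right one of the two rays from `p` tangent to the convex set `S`:
seen along this ray, `S` lies to its left. The left tangent ray is obtained by reversing the
orientation. -/
structure IsRightTangent (o : Orientation ℝ E (Fin 2)) (S : Set E) (p d : E) : Prop where
  norm_eq_one : ‖d‖ = 1
  exists_mem : ∃ t : ℝ, 0 ≤ t ∧ p + t • d ∈ S
  areaForm_nonneg : ∀ x ∈ S, 0 ≤ o.areaForm d (x - p)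

theorem isRightTangent_inv_norm_smul (hd : d ≠ 0) (hmeets : ∃ t : ℝ, 0 ≤ t ∧ p + t • d ∈ S)
    (hnonneg : ∀ x ∈ S, 0 ≤ ω d (x - p)) : IsRightTangent o S p (‖d‖⁻¹ • d) where
  norm_eq_one := norm_smul_inv_norm hd
  exists_mem := by
    obtain ⟨t, ht, hmem⟩ := hmeets
    refine ⟨t * ‖d‖, by positivity, ?_⟩
    rwa [smul_smul, mul_inv_cancel_right₀ (norm_ne_zero_iff.2 hd)]
  areaForm_nonneg x hx := by
    rw [map_smul, LinearMap.smul_apply]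
    exact mul_nonneg (by positivity) (hnonneg x hx)

namespace IsRightTangent

theorem ne_zero (hd : IsRightTangent o S p d) : d ≠ 0 :=
  norm_ne_zero_iff.1 (hd.norm_eq_one ▸ one_ne_zero)

theorem areaForm_pos (hd : IsRightTangent o S p d) {x : E} (hx : x ∈ interior S) :
    0 < ω d (x - p) :=
  areaForm_pos_of_mem_interior hd.ne_zero hd.areaForm_nonneg hx

theorem add_smul_notMem_interior (hd : IsRightTangent o S p d) (t : ℝ) :
    p + t • d ∉ interior S := fun hmem => by
  simpa using hd.areaForm_pos hmem

theorem notMem_interior (hd : IsRightTangent o S p d) : p ∉ interior S := by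
  simpa using hd.add_smul_notMem_interior 0

theorem isOutwardNormal (hd : IsRightTangent o S p d) : IsOutwardNormal S p (-(J d)) := by
  intro x hx
  rw [inner_neg_left, o.inner_rightAngleRotation_left]
  linarith [hd.areaForm_nonneg x hx]

end IsRightTangent

theorem eq_of_areaForm_eq_zero_of_notMem {k : E} (hS : Convex ℝ S) (hp : p ∉ S) (hd : ‖d‖ = 1)
    (hk : ‖k‖ = 1) (hdk : ω d k = 0) (hdS : ∃ t : ℝ, 0 ≤ t ∧ p + t • d ∈ S)
    (hkS : ∃ t : ℝ, 0 ≤ t ∧ p + t • k ∈ S) : k = d := by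
  obtain ⟨c, rfl⟩ := exists_eq_smul_of_areaForm_eq_zero
    (norm_ne_zero_iff.1 (hd ▸ one_ne_zero)) hdk
  rw [norm_smul, hd, mul_one, Real.norm_eq_abs] at hk
  rcases eq_or_eq_neg_of_abs_eq hk with rfl | rfl
  · exact one_smul ℝ d
  · exact absurd (mem_of_meets_opposite_rays hS hdS (by simpa using hkS)) hp

theorem areaForm_nonneg_of_meets {k : E} (hp : p ∉ S) (hd : ∀ x ∈ S, 0 ≤ ω d (x - p))
    (hk : ∃ t : ℝ, 0 ≤ t ∧ p + t • k ∈ S) : 0 ≤ ω d k := by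
  obtain ⟨t, ht, hmem⟩ := exists_pos_smul_mem_of_notMem hp hk
  have hdk := hd _ hmem
  rw [add_sub_cancel_left, map_smul, smul_eq_mul] at hdk
  exact nonneg_of_mul_nonneg_right hdk ht

namespace IsSmoothConvexBody

variable {k : E} (hS : IsSmoothConvexBody S)
include hS

theorem exists_isRightTangent (o : Orientation ℝ E (Fin 2)) (hp : p ∉ interior S) :
    ∃ d, IsRightTangent o S p d := by
  by_cases hpS : p ∈ S
  · obtain ⟨d, hd, hnonneg⟩ := exists_supporting_direction hS.convex hS.nonempty_interior hp
    exact ⟨_, isRightTangent_inv_norm_smul hd ⟨0, le_rfl, by simpa using hpS⟩ hnonneg⟩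
  · obtain ⟨a, ha, hnonneg⟩ := exists_extreme_direction hS.isCompact hS.convex
      (hS.nonempty_interior.mono interior_subset) hpS
    have hap : a - p ≠ 0 := sub_ne_zero.2 (ne_of_mem_of_not_mem ha hpS)
    exact ⟨_, isRightTangent_inv_norm_smul hap ⟨1, zero_le_one, by simpa using ha⟩ hnonneg⟩

theorem eq_of_isRightTangent (hd : IsRightTangent o S p d) (hk : IsRightTangent o S p k) :
    k = d := by
  by_cases hp : p ∈ S
  · have hfrontier : p ∈ frontier S := ⟨subset_closure hp, hd.notMem_interior⟩
    have hray := hS.sameRay p hfrontier _ _ hk.isOutwardNormal hd.isOutwardNormal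
    rw [sameRay_neg_iff] at hray
    exact ((SameRay.sameRay_map_iff (J).toLinearEquiv).1 hray).eq_of_norm_eq
      (hk.norm_eq_one.trans hd.norm_eq_one.symm)
  · have hdk := areaForm_nonneg_of_meets hp hd.areaForm_nonneg hk.exists_mem
    have hkd := areaForm_nonneg_of_meets hp hk.areaForm_nonneg hd.exists_mem
    rw [o.areaForm_swap] at hkd
    exact eq_of_areaForm_eq_zero_of_notMem hS.convex hp hd.norm_eq_one hk.norm_eq_one
      (by linarith) hd.exists_mem hk.exists_mem

end IsSmoothConvexBody

open Classical in
/-- The direction of the right tangent ray from `p` to the smooth convex body `S`, or `0` if `p` is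
an interior point of `S`. -/
noncomputable def rightTangent (o : Orientation ℝ E (Fin 2)) (S : Set E) (p : E) : E :=
  if h : ∃ d, IsRightTangent o S p d then h.choose else 0

theorem rightTangent_of_mem_interior (hp : p ∈ interior S) : rightTangent o S p = 0 :=
  dif_neg fun ⟨_, hd⟩ => hd.notMem_interior hp

namespace IsSmoothConvexBody

variable (hS : IsSmoothConvexBody S)
include hS

theorem isRightTangent_rightTangent (o : Orientation ℝ E (Fin 2)) (hp : p ∉ interior S) :
    IsRightTangent o S p (rightTangent o S p) := by
  have hex := hS.exists_isRightTangent o hp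
  rw [rightTangent, dif_pos hex]
  exact hex.choose_spec

theorem isRightTangent_iff (hp : p ∉ interior S) :
    IsRightTangent o S p d ↔ d = rightTangent o S p :=
  ⟨fun hd => hS.eq_of_isRightTangent (hS.isRightTangent_rightTangent o hp) hd,
    fun hd => hd ▸ hS.isRightTangent_rightTangent o hp⟩

theorem areaForm_rightTangent_pos (o : Orientation ℝ E (Fin 2)) (hp : p ∉ S) :
    0 < o.areaForm (rightTangent o S p) (rightTangent (-o) S p) := by
  have hp' : p ∉ interior S := fun h => hp (interior_subset h)
  have hright := hS.isRightTangent_rightTangent o hp'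
  have hleft := hS.isRightTangent_rightTangent (-o) hp'
  refine (areaForm_nonneg_of_meets hp hright.areaForm_nonneg hleft.exists_mem).lt_of_ne' fun h => ?_
  have heq := eq_of_areaForm_eq_zero_of_notMem hS.convex hp hright.norm_eq_one hleft.norm_eq_one h
    hright.exists_mem hleft.exists_mem
  obtain ⟨x, hx⟩ := hS.nonempty_interior
  have hneg := hleft.areaForm_pos hx
  rw [heq, areaForm_neg_orientation_apply, o.areaForm_swap] at hneg
  linarith [hright.areaForm_pos hx]

theorem exists_eq_smul_add_smul_of_meets (o : Orientation ℝ E (Fin 2)) (hp : p ∉ S)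
    (hd : ∃ t : ℝ, 0 ≤ t ∧ p + t • d ∈ S) :
    ∃ a b : ℝ, 0 ≤ a ∧ 0 ≤ b ∧
      d = a • rightTangent o S p + b • rightTangent (-o) S p := by
  have hp' : p ∉ interior S := fun h => hp (interior_subset h)
  have hpos := hS.areaForm_rightTangent_pos o hp
  have hright := areaForm_nonneg_of_meets hp
    (hS.isRightTangent_rightTangent o hp').areaForm_nonneg hd
  have hleft := areaForm_nonneg_of_meets hp
    (hS.isRightTangent_rightTangent (-o) hp').areaForm_nonneg hd
  rw [areaForm_neg_orientation_apply] at hleft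
  refine ⟨_, _, div_nonneg hleft hpos.le, div_nonneg hright hpos.le, ?_⟩
  refine smul_right_injective E hpos.ne' ?_
  simp only [smul_add, smul_smul, mul_div_cancel₀ _ hpos.ne']
  exact areaForm_smul_eq_areaForm_smul_add o _ _ d

theorem meets_normalReflection (o : Orientation ℝ E (Fin 2)) (hp : p ∉ interior S)
    (hd : ∃ t : ℝ, 0 ≤ t ∧ p + t • d ∈ S) :
    ∃ t : ℝ, 0 ≤ t ∧
      p + t • normalReflection (rightTangent o S p - rightTangent (-o) S p) d ∈ S := by
  by_cases hpS : p ∈ S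
  · exact ⟨0, le_rfl, by simpa using hpS⟩
  obtain ⟨a, b, ha, hb, rfl⟩ := hS.exists_eq_smul_add_smul_of_meets o hpS hd
  have hright := hS.isRightTangent_rightTangent o hp
  have hleft := hS.isRightTangent_rightTangent (-o) hp
  have hnorm := hright.norm_eq_one.trans hleft.norm_eq_one.symm
  have hab : 0 < b + a := by
    refine (add_nonneg hb ha).lt_of_ne' fun hzero => hpS ?_
    obtain ⟨rfl, rfl⟩ : a = 0 ∧ b = 0 := ⟨by linarith, by linarith⟩
    simpa using hd.choose_spec.2
  simp only [map_add, map_smul, normalReflection_sub_left hnorm, normalReflection_sub_right hnorm]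
  rw [add_comm (a • _)]
  exact meets_smul_add_smul hS.convex (exists_pos_smul_mem_of_notMem hpS hright.exists_mem)
    (exists_pos_smul_mem_of_notMem hpS hleft.exists_mem) hb ha hab

end IsSmoothConvexBody

end Tangents

section HitTime

variable {E : Type*} [NormedAddCommGroup E] [NormedSpace ℝ E] {S : Set E} {p v : E}

/-- The first time at which the ray from `p` with velocity `v` is in `S`, `0` if there is none. -/
noncomputable def hitTime (S : Set E) (p v : E) : ℝ := sInf {t : ℝ | 0 ≤ t ∧ p + t • v ∈ S}

theorem hitTime_nonneg (S : Set E) (p v : E) : 0 ≤ hitTime S p v :=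
  Real.sInf_nonneg fun _ ht => ht.1

theorem hitTime_le {t : ℝ} (ht : 0 ≤ t) (hmem : p + t • v ∈ S) : hitTime S p v ≤ t :=
  csInf_le ⟨0, fun _ hs => hs.1⟩ ⟨ht, hmem⟩

theorem add_hitTime_smul_mem (hS : IsClosed S) (hmeets : ∃ t : ℝ, 0 ≤ t ∧ p + t • v ∈ S) :
    p + hitTime S p v • v ∈ S := by
  have hclosed : IsClosed {t : ℝ | 0 ≤ t ∧ p + t • v ∈ S} :=
    isClosed_Ici.inter (hS.preimage (by fun_prop))
  exact (hclosed.csInf_mem hmeets ⟨0, fun _ hs => hs.1⟩).2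

theorem add_hitTime_smul_notMem_interior (hp : p ∉ interior S) :
    p + hitTime S p v • v ∉ interior S := by
  intro hmem
  have hpos : 0 < hitTime S p v :=
    (hitTime_nonneg S p v).lt_of_ne fun h0 => hp (by simpa [← h0] using hmem)
  have hcont : Continuous fun t : ℝ => p + t • v := by fun_prop
  have hev : ∀ᶠ t in nhds (hitTime S p v), p + t • v ∈ interior S ∧ 0 < t :=
    (hcont.continuousAt.eventually_mem (isOpen_interior.mem_nhds hmem)).and (lt_mem_nhds hpos)
  obtain ⟨t, ht, hlt⟩ := ((hev.filter_mono nhdsWithin_le_nhds).and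
    (self_mem_nhdsWithin (s := Iio (hitTime S p v)))).exists
  exact (hitTime_le ht.2.le (interior_subset ht.1)).not_gt hlt

theorem isClosed_meets_within (hS : IsClosed S) (a : ℝ) :
    IsClosed {z : E × E | ∃ t : ℝ, (0 ≤ t ∧ t ≤ a) ∧ z.1 + t • z.2 ∈ S} := by
  have hclosed : IsClosed {q : (E × E) × Icc 0 a | q.1.1 + (q.2 : ℝ) • q.1.2 ∈ S} :=
    hS.preimage (by fun_prop)
  convert! isClosedMap_fst_of_compactSpace _ hclosed using 1
  ext z
  simp

variable [MeasurableSpace E] [BorelSpace E] [SecondCountableTopology E]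

theorem measurableSet_meets (hS : IsClosed S) :
    MeasurableSet {z : E × E | ∃ t : ℝ, 0 ≤ t ∧ z.1 + t • z.2 ∈ S} := by
  have hunion : {z : E × E | ∃ t : ℝ, 0 ≤ t ∧ z.1 + t • z.2 ∈ S} =
      ⋃ n : ℕ, {z : E × E | ∃ t : ℝ, (0 ≤ t ∧ t ≤ n) ∧ z.1 + t • z.2 ∈ S} := by
    ext z
    simp only [mem_ofPred_eq, mem_iUnion]
    refine ⟨fun ⟨t, ht, hmem⟩ => ?_, fun ⟨_, t, ht, hmem⟩ => ⟨t, ht.1, hmem⟩⟩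
    obtain ⟨n, hn⟩ := exists_nat_ge t
    exact ⟨n, t, ⟨ht, hn⟩, hmem⟩
  rw [hunion]
  exact .iUnion fun n => (isClosed_meets_within hS n).measurableSet

theorem measurable_hitTime (hS : IsClosed S) :
    Measurable fun z : E × E => hitTime S z.1 z.2 := by
  refine measurable_of_restrict_of_restrict_compl (measurableSet_meets hS) ?_ ?_
  · refine measurable_of_Iic fun a => ?_
    convert! measurable_subtype_coe (isClosed_meets_within hS a).measurableSet using 1
    ext ⟨z, hz⟩
    exact ⟨fun h => ⟨_, ⟨hitTime_nonneg _ _ _, h⟩, add_hitTime_smul_mem hS hz⟩,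
      fun ⟨t, ht, h⟩ => (hitTime_le ht.1 h).trans ht.2⟩
  · convert! measurable_const (a := (0 : ℝ)) using 1
    ext ⟨z, hz⟩
    have hempty : {t : ℝ | 0 ≤ t ∧ z.1 + t • z.2 ∈ S} = ∅ :=
      eq_empty_of_forall_notMem fun t ht => hz ⟨t, ht⟩
    simp [hitTime, hempty]

end HitTime

/-- By the Lusin–Souslin theorem: images of Borel sets under injective Borel maps are Borel. -/
theorem measurable_of_measurableSet_graph {α β : Type*} [MeasurableSpace α]
    [StandardBorelSpace α] [MeasurableSpace β] [StandardBorelSpace β] {f : α → β}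
    (hgraph : MeasurableSet {z : α × β | z.2 = f z.1}) : Measurable f := by
  intro B hB
  have himage : MeasurableSet (Prod.fst '' ({z : α × β | z.2 = f z.1} ∩ Prod.snd ⁻¹' B)) := by
    refine (hgraph.inter (measurable_snd hB)).image_of_measurable_injOn measurable_fst ?_
    rintro ⟨a, b⟩ ⟨hb, -⟩ ⟨a', b'⟩ ⟨hb', -⟩ (rfl : a = a')
    exact Prod.ext rfl (hb.trans hb'.symm)
  convert! himage using 1
  ext a
  simp

section TangentsOfSmoothBodies

variable {E : Type*} [NormedAddCommGroup E] [InnerProductSpace ℝ E]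
  [Fact (Module.finrank ℝ E = 2)] {o : Orientation ℝ E (Fin 2)} {S : Set E} {p v h w : E}

local notation "ω" => o.areaForm

theorem isRightTangent_or_of_line_disjoint_interior (o : Orientation ℝ E (Fin 2))
    (hS : Convex ℝ S) (hint : (interior S).Nonempty) (hv : ‖v‖ = 1)
    (hmeets : ∃ t : ℝ, 0 ≤ t ∧ p + t • v ∈ S) (hline : ∀ t : ℝ, p + t • v ∉ interior S) :
    IsRightTangent o S p v ∨ IsRightTangent (-o) S p v :=
  (areaForm_nonneg_or_nonpos_of_line_disjoint_interior hS hint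
    (norm_ne_zero_iff.1 (hv ▸ one_ne_zero)) hline).imp (⟨hv, hmeets, ·⟩) (⟨hv, hmeets, ·⟩)

theorem IsRightTangent.neg (hh : IsRightTangent (-o) S w h) (hw : w ∈ S) :
    IsRightTangent o S w (-h) where
  norm_eq_one := (norm_neg h).trans hh.norm_eq_one
  exists_mem := ⟨0, le_rfl, by simpa using hw⟩
  areaForm_nonneg x hx := by
    have hnonneg := hh.areaForm_nonneg x hx
    rwa [areaForm_neg_orientation_apply, o.areaForm_swap, ← LinearMap.neg_apply, ← map_neg]
      at hnonneg

namespace IsSmoothConvexBody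

variable (hS : IsSmoothConvexBody S)
include hS

theorem exists_add_smul_mem_interior (hw : w ∈ S) (hh : IsRightTangent o S w h) (hv : ‖v‖ = 1)
    (hhv : ω h v ≠ 0) : ∃ t : ℝ, w + t • v ∈ interior S := by
  by_contra! hline
  rcases isRightTangent_or_of_line_disjoint_interior o hS.convex hS.nonempty_interior hv
    ⟨0, le_rfl, by simpa using hw⟩ hline with hright | hleft
  · simp [hS.eq_of_isRightTangent hh hright] at hhv
  · simp [← hS.eq_of_isRightTangent hh (hleft.neg hw)] at hhv

theorem hitTime_mul_areaForm_nonneg (hv : ‖v‖ = 1) (hmeets : ∃ t : ℝ, 0 ≤ t ∧ p + t • v ∈ S)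
    (hh : IsRightTangent o S (p + hitTime S p v • v) h) : 0 ≤ hitTime S p v * ω h v := by
  by_contra! hneg
  have ht : 0 < hitTime S p v :=
    (hitTime_nonneg S p v).lt_of_ne' fun h0 => by simp [h0] at hneg
  have hhv : ω h v < 0 := by simpa [ht.not_gt, ht] using mul_neg_iff.1 hneg
  have hmem := add_hitTime_smul_mem hS.isCompact.isClosed hmeets
  obtain ⟨a, ha⟩ := hS.exists_add_smul_mem_interior hmem hh hv hhv.ne
  have hpos := hh.areaForm_pos ha
  rw [add_sub_cancel_left, map_smul, smul_eq_mul] at hpos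
  have ha0 : a < 0 := neg_of_mul_pos_left hpos hhv.le
  set c := max (-hitTime S p v) a
  have hc0 : c < 0 := max_lt (neg_lt_zero.2 ht) ha0
  have hearlier : p + hitTime S p v • v + c • v ∈ S := by
    convert! hS.convex.add_smul_sub_mem hmem (interior_subset ha) (t := c / a)
      ⟨div_nonneg_of_nonpos hc0.le ha0.le, (div_le_one_of_neg ha0).2 (le_max_right _ _)⟩ using 1
    rw [add_sub_cancel_left, smul_smul, div_mul_cancel₀ _ ha0.ne]
  rw [add_assoc, ← add_smul] at hearlier
  linarith [hitTime_le (by linarith [le_max_left (-hitTime S p v) a]) hearlier]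

theorem measurable_rightTangent [MeasurableSpace E] [BorelSpace E]
    (o : Orientation ℝ E (Fin 2)) : Measurable (rightTangent o S) := by
  have := FiniteDimensional.of_fact_finrank_eq_two (K := ℝ) (V := E)
  have hgraph : {z : E × E | z.2 = rightTangent o S z.1} =
      {z | z.1 ∉ interior S ∧ IsRightTangent o S z.1 z.2} ∪ {z | z.1 ∈ interior S ∧ z.2 = 0} := by
    ext ⟨p, d⟩
    by_cases hp : p ∈ interior S
    · simp [hp, rightTangent_of_mem_interior hp]
    · simp [hp, hS.isRightTangent_iff hp]
  have hinterior : MeasurableSet {z : E × E | z.1 ∈ interior S} :=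
    isOpen_interior.measurableSet.preimage measurable_fst
  have htangent : MeasurableSet {z : E × E | IsRightTangent o S z.1 z.2} := by
    have hnonneg : IsClosed {z : E × E | ∀ x ∈ S, 0 ≤ o.areaForm z.2 (x - z.1)} := by
      have hcont (x : E) : Continuous fun z : E × E => o.areaForm z.2 (x - z.1) :=
        continuous_areaForm.comp (by fun_prop : Continuous fun z : E × E => (z.2, x - z.1))
      simp only [ofPred_forall]
      exact isClosed_biInter fun x _ => isClosed_Ici.preimage (hcont x)
    have hnorm : IsClosed {z : E × E | ‖z.2‖ = 1} := isClosed_eq (by fun_prop) (by fun_prop)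
    convert! hnorm.measurableSet.inter ((measurableSet_meets hS.isCompact.isClosed).inter
      hnonneg.measurableSet) using 1
    ext z
    exact ⟨fun hz => ⟨hz.1, hz.2, hz.3⟩, fun hz => ⟨hz.1, hz.2.1, hz.2.2⟩⟩
  refine measurable_of_measurableSet_graph ?_
  rw [hgraph]
  exact (hinterior.compl.inter htangent).union
    (hinterior.inter (measurable_snd (measurableSet_singleton 0)))

end IsSmoothConvexBody

end TangentsOfSmoothBodies

section FiberReflections

theorem measurable_unitMap_normalReflection {α : Type*} [MeasurableSpace α] {g : α → Plane}
    {v : α → UnitVec} (hg : Measurable g) (hv : Measurable v) :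
    Measurable fun a => unitMap (normalReflection (g a)) (v a) :=
  (measurable_normalReflection.comp
    (hg.prodMk (measurable_subtype_coe.comp hv))).subtype_mk

/-- The map of the unit tangent bundle of the plane that fixes base points and reflects the
directions at `x` in the line orthogonal to `g x`. -/
noncomputable def fiberReflection (g : Plane → Plane) (z : Plane × UnitVec) : Plane × UnitVec :=
  (z.1, unitMap (normalReflection (g z.1)) z.2)

theorem fiberReflection_fiberReflection (g : Plane → Plane) (z : Plane × UnitVec) :
    fiberReflection g (fiberReflection g z) = z :=
  Prod.ext rfl (Subtype.ext (normalReflection_normalReflection _ _))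

theorem measurePreserving_fiberReflection {g : Plane → Plane} (hg : Measurable g) :
    MeasurePreserving (fiberReflection g) phaseMeasure phaseMeasure :=
  (MeasurePreserving.id volume).skew_product
    (g := fun x => unitMap (normalReflection (g x)))
    (measurable_unitMap_normalReflection (hg.comp measurable_fst) measurable_snd)
    (.of_forall fun _ => (measurePreserving_unitMap _).map_eq)

end FiberReflections

section PlaneTangents

instance : Fact (Module.finrank ℝ Plane = 2) := ⟨finrank_euclideanSpace_fin⟩

/-- The counterclockwise orientation of the plane. -/
noncomputable def planeOrientation : Orientation ℝ Plane (Fin 2) :=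
  (EuclideanSpace.basisFun (Fin 2) ℝ).toBasis.orientation

theorem areaForm_planeOrientation (x y : Plane) :
    planeOrientation.areaForm x y = x 0 * y 1 - x 1 * y 0 := by
  rw [Orientation.areaForm_to_volumeForm,
    planeOrientation.volumeForm_robust (EuclideanSpace.basisFun (Fin 2) ℝ) rfl,
    Module.Basis.det_apply, Matrix.det_fin_two]
  simp [Module.Basis.toMatrix_apply]
  ring

variable {S : Set Plane} {p w d : Plane}

theorem isTangentDir_iff (o : Orientation ℝ Plane (Fin 2)) (hS : Convex ℝ S)
    (hint : (interior S).Nonempty) :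
    IsTangentDir S p d ↔ IsRightTangent o S p d ∨ IsRightTangent (-o) S p d := by
  refine ⟨fun ⟨hd, hmeets, hline⟩ =>
    isRightTangent_or_of_line_disjoint_interior o hS hint hd hmeets hline, ?_⟩
  rintro (hd | hd) <;> exact ⟨hd.norm_eq_one, hd.exists_mem, hd.add_smul_notMem_interior⟩

namespace IsSmoothConvexBody

variable (hS : IsSmoothConvexBody S) (o : Orientation ℝ Plane (Fin 2))
include hS

theorem bisectorLine_eq (hp : p ∉ interior S) :
    bisectorLine S p = (ℝ ∙ (rightTangent o S p - rightTangent (-o) S p))ᗮ := by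
  ext x
  rw [Submodule.mem_orthogonal_singleton_iff_inner_right, inner_sub_left, sub_eq_zero]
  change (∀ h k, IsTangentDir S p h → IsTangentDir S p k → ⟪h, x⟫ = ⟪k, x⟫) ↔ _
  simp only [isTangentDir_iff o hS.convex hS.nonempty_interior, hS.isRightTangent_iff hp]
  refine ⟨fun hx => hx _ _ (.inl rfl) (.inr rfl), fun hx => ?_⟩
  rintro _ _ (rfl | rfl) (rfl | rfl) <;> simp only [hx]

theorem tangentLine_eq (hw : w ∈ frontier S) : tangentLine S w = ℝ ∙ rightTangent o S w := by
  have hh := hS.isRightTangent_rightTangent o hw.2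
  set h := rightTangent o S w
  refine le_antisymm (fun y hy => ?_) ?_
  · have hy0 := hy _ (Submodule.subset_span hh.isOutwardNormal)
    rw [inner_neg_left, o.inner_rightAngleRotation_left, neg_eq_zero] at hy0
    obtain ⟨c, rfl⟩ := exists_eq_smul_of_areaForm_eq_zero hh.ne_zero hy0
    exact Submodule.smul_mem _ c (Submodule.mem_span_singleton_self h)
  · rw [tangentLine, Submodule.le_orthogonal_iff_le_orthogonal, Submodule.span_le]
    intro n hn
    have hne : -(o.rightAngleRotation h) ≠ 0 :=
      neg_ne_zero.2 ((map_ne_zero_iff _ o.rightAngleRotation.injective).2 hh.ne_zero)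
    obtain ⟨r, -, rfl⟩ := (hS.sameRay w hw _ n hh.isOutwardNormal hn).exists_nonneg_left hne
    simp [Submodule.mem_orthogonal_singleton_iff_inner_right, inner_smul_right]

end IsSmoothConvexBody

end PlaneTangents

section BilliardMaps

variable {S : Set Plane}

/-- The first half of the bouncing outer billiard map: `(p, v)` is mapped to `(p', u)`, where `u` is
the direction from `p'` back to the bounce point. -/
noncomputable def bounceMap (S : Set Plane) (z : Plane × UnitVec) : Plane × UnitVec :=
  let u := unitMap (normalReflection (rightTangent planeOrientation S (bouncePoint S z.1 z.2))) z.2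
  (bouncePoint S z.1 z.2 - hitTime S z.1 z.2 • (u : Plane), u)

/-- The second half of the bouncing outer billiard map: directions are reflected across the bisector
of the two tangent rays. -/
noncomputable def bisectorMap (S : Set Plane) : Plane × UnitVec → Plane × UnitVec :=
  fiberReflection fun p => rightTangent planeOrientation S p - rightTangent (-planeOrientation) S p

theorem bouncePoint_eq_add_hitTime_smul (S : Set Plane) (p v : Plane) :
    bouncePoint S p v = p + hitTime S p v • v :=
  rfl

theorem measurableSet_visibilityDomain (hS : IsClosed S) : MeasurableSet (visibilityDomain S) :=
  (isOpen_interior.measurableSet.preimage measurable_fst).compl.inter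
    ((measurableSet_meets hS).preimage
      (measurable_fst.prodMk (measurable_subtype_coe.comp measurable_snd)))

namespace IsSmoothConvexBody

variable (hS : IsSmoothConvexBody S)
include hS

theorem measurePreserving_bisectorMap :
    MeasurePreserving (bisectorMap S) phaseMeasure phaseMeasure :=
  measurePreserving_fiberReflection
    ((hS.measurable_rightTangent _).sub (hS.measurable_rightTangent _))

theorem mapsTo_bisectorMap :
    MapsTo (bisectorMap S) (visibilityDomain S) (visibilityDomain S) :=
  fun _ hz => ⟨hz.1, hS.meets_normalReflection planeOrientation hz.1 hz.2⟩

theorem measurePreserving_bisectorMap_restrict :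
    MeasurePreserving (bisectorMap S) (phaseMeasure.restrict (visibilityDomain S))
      (phaseMeasure.restrict (visibilityDomain S)) := by
  have hinvariant : bisectorMap S ⁻¹' visibilityDomain S = visibilityDomain S :=
    Subset.antisymm
      (fun z hz => fiberReflection_fiberReflection _ z ▸ hS.mapsTo_bisectorMap hz)
      hS.mapsTo_bisectorMap
  simpa only [hinvariant] using hS.measurePreserving_bisectorMap.restrict_preimage
    (measurableSet_visibilityDomain hS.isCompact.isClosed)

theorem bouncePoint_mem_frontier {z : Plane × UnitVec} (hz : z ∈ visibilityDomain S) :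
    bouncePoint S z.1 z.2 ∈ frontier S :=
  hS.isCompact.isClosed.frontier_eq ▸
    ⟨add_hitTime_smul_mem hS.isCompact.isClosed hz.2, add_hitTime_smul_notMem_interior hz.1⟩

theorem measurable_bounceMap : Measurable (bounceMap S) := by
  have hdirection : Measurable fun z : Plane × UnitVec => (z.2 : Plane) :=
    measurable_subtype_coe.comp measurable_snd
  have htime := (measurable_hitTime hS.isCompact.isClosed).comp (measurable_fst.prodMk hdirection)
  have hpoint : Measurable fun z : Plane × UnitVec => bouncePoint S z.1 z.2 :=
    measurable_fst.add (htime.smul hdirection)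
  have hreflected : Measurable fun z : Plane × UnitVec => (bounceMap S z).2 :=
    measurable_unitMap_normalReflection
      ((hS.measurable_rightTangent planeOrientation).comp hpoint) measurable_snd
  have hbase : Measurable fun z : Plane × UnitVec => (bounceMap S z).1 :=
    hpoint.sub (htime.smul (measurable_subtype_coe.comp hreflected))
  exact hbase.prodMk hreflected

theorem mapsTo_bounceMap : MapsTo (bounceMap S) (visibilityDomain S) (visibilityDomain S) := by
  intro z hz
  have hw := hS.bouncePoint_mem_frontier hz
  have hh := hS.isRightTangent_rightTangent planeOrientation hw.2
  refine ⟨fun hinterior => ?_, hitTime S z.1 z.2, hitTime_nonneg _ _ _, ?_⟩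
  · have hpos := hh.areaForm_pos hinterior
    have hnonneg := hS.hitTime_mul_areaForm_nonneg (norm_eq_of_mem_sphere z.2) hz.2 hh
    rw [bounceMap, sub_sub_cancel_left, map_neg, map_smul, coe_unitMap, areaForm_normalReflection,
      smul_eq_mul] at hpos
    exact (neg_pos.1 hpos).not_ge hnonneg
  · rw [bounceMap]
    exact (sub_add_cancel (bouncePoint S z.1 z.2) _).symm ▸
      hS.isCompact.isClosed.frontier_subset hw

theorem reflectedDir_eq {z : Plane × UnitVec} (hz : z ∈ visibilityDomain S) :
    reflectedDir S z.1 z.2 = -(bounceMap S z).2 := by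
  simp only [reflectedDir, hS.tangentLine_eq planeOrientation (hS.bouncePoint_mem_frontier hz)]
  exact reflection_span_singleton_eq_neg_normalReflection _ _

theorem nextPoint_eq {z : Plane × UnitVec} (hz : z ∈ visibilityDomain S) :
    nextPoint S z.1 z.2 = (bounceMap S z).1 := by
  have hdist : dist z.1 (bouncePoint S z.1 z.2) = hitTime S z.1 z.2 := by
    rw [bouncePoint_eq_add_hitTime_smul, dist_self_add_right, norm_smul,
      norm_eq_of_mem_sphere, mul_one, Real.norm_of_nonneg (hitTime_nonneg _ _ _)]
  rw [nextPoint, hdist, hS.reflectedDir_eq hz, smul_neg, ← sub_eq_add_neg]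
  rfl

theorem eqOn_bouncingOuterBilliard :
    EqOn (bisectorMap S ∘ bounceMap S) (bouncingOuterBilliard S) (visibilityDomain S) := by
  intro z hz
  refine (Prod.ext (hS.nextPoint_eq hz) (Subtype.ext ?_)).symm
  simp only [bouncingOuterBilliard, nextDir, hS.nextPoint_eq hz, hS.reflectedDir_eq hz, neg_neg,
    hS.bisectorLine_eq planeOrientation (hS.mapsTo_bounceMap hz).1]
  rfl

end IsSmoothConvexBody

end BilliardMaps

section MeasurePreservingMaps

variable {α β : Type*} [MeasurableSpace α] [MeasurableSpace β] {μ : Measure α} {ν : Measure β}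

theorem measurePreserving_withDensity_comp {f : α → β} {ρ : β → ENNReal}
    (hf : MeasurePreserving f μ ν) (hρ : Measurable ρ) :
    MeasurePreserving f (μ.withDensity (ρ ∘ f)) (ν.withDensity ρ) := by
  refine ⟨hf.measurable, Measure.ext fun B hB => ?_⟩
  rw [Measure.map_apply hf.measurable hB, withDensity_apply _ (hf.measurable hB),
    withDensity_apply _ hB]
  exact hf.setLIntegral_comp_preimage hB hρ

theorem measurePreserving_of_ae_semiconj {f : α → β} {a : α → α} {b : β → β}
    (hf : MeasurePreserving f μ ν) (ha : MeasurePreserving a μ μ) (hb : Measurable b)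
    (hfab : ∀ᵐ x ∂μ, f (a x) = b (f x)) : MeasurePreserving b ν ν := by
  have hbf := ((hf.comp ha).congr (hb.comp hf.measurable) hfab).map_of_comp hb hf.measurable
  rwa [hf.map_eq] at hbf

theorem measurePreserving_mapsTo_restrict {T F : α → α} {V : Set α} (hV : MeasurableSet V)
    (hT : MeasurePreserving T (μ.restrict V) (μ.restrict V)) (heq : EqOn T F V)
    (hF : MapsTo F V V) :
    MeasurePreserving (hF.restrict F V V) (μ.comap Subtype.val) (μ.comap Subtype.val) := by
  have hval := measurePreserving_subtype_coe (μa := μ) hV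
  have hcoe : Subtype.val ∘ hF.restrict F V V = T ∘ Subtype.val :=
    funext fun z => (heq z.2).symm
  have hcomp : MeasurePreserving (Subtype.val ∘ hF.restrict F V V) (μ.comap Subtype.val)
      (μ.restrict V) := hcoe ▸ hT.comp hval
  have hmeas : Measurable (hF.restrict F V V) :=
    (MeasurableEmbedding.subtype_coe hV).measurable_comp_iff.1 hcomp.measurable
  refine ⟨hmeas, ?_⟩
  rw [← (MeasurableEmbedding.subtype_coe hV).comap_map (Measure.map _ _),
    Measure.map_map measurable_subtype_coe hmeas, hcomp.map_eq, ← hval.map_eq,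
    (MeasurableEmbedding.subtype_coe hV).comap_map]

variable {δ : Type*} [MeasurableSpace δ] {κ : Measure δ} [SFinite μ] [SFinite ν] [SFinite κ]

theorem measurePreserving_prodMk_of_forall {f : β → α → δ} {ρ : α × β → ENNReal}
    {V : Set (δ × β)} (hf : Measurable fun z : α × β => (f z.2 z.1, z.2)) (hρ : Measurable ρ)
    (hV : MeasurableSet V)
    (hfiber : ∀ b, MeasurePreserving (f b) (μ.withDensity fun x => ρ (x, b))
      (κ.restrict {y | (y, b) ∈ V})) :
    MeasurePreserving (fun z : α × β => (f z.2 z.1, z.2)) ((μ.prod ν).withDensity ρ)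
      ((κ.prod ν).restrict V) := by
  refine ⟨hf, Measure.ext fun B hB => ?_⟩
  have hBslice (b : β) : MeasurableSet {y | (y, b) ∈ B} := hB.preimage measurable_prodMk_right
  rw [Measure.map_apply hf hB, withDensity_apply _ (hf hB), ← lintegral_indicator (hf hB),
    lintegral_prod_symm _ (hρ.indicator (hf hB)).aemeasurable, Measure.restrict_apply hB,
    Measure.prod_apply_symm (hB.inter hV)]
  refine lintegral_congr fun b => ?_
  have hslice := (hfiber b).measure_preimage (hBslice b).nullMeasurableSet
  rw [withDensity_apply _ ((hfiber b).measurable (hBslice b)),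
    ← lintegral_indicator ((hfiber b).measurable (hBslice b)),
    Measure.restrict_apply (hBslice b)] at hslice
  exact hslice

end MeasurePreservingMaps

section MeasuresOfRays

variable {E : Type*} [NormedAddCommGroup E] [NormedSpace ℝ E] {S : Set E}

theorem exists_pos_forall_add_smul_notMem (hS : Bornology.IsBounded S) {v : E} (hv : v ≠ 0) :
    ∃ r : ℝ, 0 < r ∧ ∀ (x : E) (a b : ℝ), x + a • v ∈ S → a + r ≤ b → x + b • v ∉ S := by
  obtain ⟨R, hR, hdist⟩ := hS.exists_pos_norm_le
  have hv' := norm_pos_iff.2 hv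
  refine ⟨3 * R / ‖v‖, by positivity, fun x a b ha hab hb => ?_⟩
  have hba : 3 * R / ‖v‖ ≤ b - a := by linarith
  have hle : ‖(b - a) • v‖ ≤ R + R := by
    convert! (norm_sub_le _ _).trans (add_le_add (hdist _ hb) (hdist _ ha)) using 2
    module
  have hge : 3 * R ≤ ‖(b - a) • v‖ := by
    rw [norm_smul, ← div_le_iff₀ hv']
    exact hba.trans (le_abs_self _)
  linarith

variable [MeasurableSpace E] [BorelSpace E] (μ : Measure E)

theorem measure_meets_diff_interior_eq_top [μ.IsAddRightInvariant] [μ.IsOpenPosMeasure]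
    (hS : Bornology.IsBounded S) (hint : (interior S).Nonempty) {v : E} (hv : v ≠ 0) :
    μ {p | p ∉ interior S ∧ ∃ t : ℝ, 0 ≤ t ∧ p + t • v ∈ S} = ⊤ := by
  obtain ⟨r, hr, hleave⟩ := exists_pos_forall_add_smul_notMem hS hv
  let translate (n : ℕ) : Set E := (fun p => p + ((n + 1) * r) • v) ⁻¹' interior S
  have hdisjoint : Pairwise (Disjoint on translate) := by
    refine (pairwise_disjoint_on _).2 fun m n hmn => disjoint_left.2 fun p hm hn => ?_
    have hmn' : (m : ℝ) + 1 ≤ n := by exact_mod_cast hmn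
    exact hleave p _ _ (interior_subset hm) (by nlinarith) (interior_subset hn)
  have hsubset : ⋃ n, translate n ⊆ {p | p ∉ interior S ∧ ∃ t : ℝ, 0 ≤ t ∧ p + t • v ∈ S} := by
    refine iUnion_subset fun n p hp => ⟨fun hpS => ?_, (n + 1) * r, by positivity,
      interior_subset hp⟩
    have hpS' : p + (0 : ℝ) • v ∈ S := by simpa using interior_subset hpS
    exact hleave p 0 _ hpS' (by nlinarith [n.cast_nonneg (α := ℝ)]) (interior_subset hp)
  refine measure_mono_top hsubset ?_
  rw [measure_iUnion hdisjoint fun n =>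
    isOpen_interior.measurableSet.preimage (measurable_add_const _)]
  simp only [translate, measure_preimage_add_right]
  exact ENNReal.tsum_const_eq_top_of_ne_zero (isOpen_interior.measure_ne_zero μ hint)

theorem measure_meets_line_disjoint_interior_eq_zero [FiniteDimensional ℝ E] [μ.IsAddHaarMeasure]
    (hS : Convex ℝ S) (hint : (interior S).Nonempty) (v : E) :
    μ {p | (∃ t : ℝ, p + t • v ∈ S) ∧ ∀ t : ℝ, p + t • v ∉ interior S} = 0 := by
  set U : Set E := {p | ∃ t : ℝ, p + t • v ∈ interior S}
  have hconvex : Convex ℝ U := by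
    rintro x ⟨a, ha⟩ y ⟨b, hb⟩ α β hα hβ hαβ
    refine ⟨α * a + β * b, ?_⟩
    convert! hS.interior ha hb hα hβ hαβ using 1
    module
  refine measure_mono_null ?_ (hconvex.addHaar_frontier μ)
  rintro p ⟨⟨t, ht⟩, hp⟩
  refine ⟨?_, fun hmem => (interior_subset hmem).elim hp⟩
  have hclosure : p + t • v ∈ closure (interior S) := by
    rw [hS.closure_interior_eq_closure_of_nonempty_interior hint]
    exact subset_closure ht
  have hcont : Continuous fun y : E => y - t • v := by fun_prop
  simpa using map_mem_closure hcont hclosure (t := U) fun y hy => ⟨t, by simpa using hy⟩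

end MeasuresOfRays

theorem phaseMeasure_visibilityDomain {S : Set Plane} (hS : IsCompact S)
    (hint : (interior S).Nonempty) : phaseMeasure (visibilityDomain S) = ⊤ := by
  rw [phaseMeasure, Measure.prod_apply_symm (measurableSet_visibilityDomain hS.isClosed)]
  have hslice (v : UnitVec) : volume ((fun p => (p, v)) ⁻¹' visibilityDomain S) = ⊤ :=
    measure_meets_diff_interior_eq_top volume hS.isBounded hint (ne_zero_of_mem_unit_sphere v)
  simp only [hslice, lintegral_const]
  exact ENNReal.top_mul (NeZero.ne _)

section BoundaryCurves

variable {E : Type*} [NormedAddCommGroup E] [InnerProductSpace ℝ E] {S : Set E} {γ : ℝ → E}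
  {γ' : E} {s : ℝ}

theorem IsOutwardNormal.inner_hasDerivAt_eq_zero {n : E} (hn : IsOutwardNormal S (γ s) n)
    (hγ : HasDerivAt γ γ' s) (hmem : ∀ u, γ u ∈ S) : ⟪n, γ'⟫ = 0 := by
  have hmax : IsLocalMax (fun u => ⟪n, γ u⟫) s := .of_forall fun u =>
    sub_nonpos.1 ((inner_sub_right n (γ u) (γ s)).symm.trans_le (hn _ (hmem u)))
  exact hmax.hasDerivAt_eq_zero ((innerSL ℝ n).hasFDerivAt.comp_hasDerivAt s hγ)

variable [Fact (Module.finrank ℝ E = 2)]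

theorem IsRightTangent.exists_hasDerivAt_eq_smul {o : Orientation ℝ E (Fin 2)} {h : E}
    (hh : IsRightTangent o S (γ s) h) (hγ : HasDerivAt γ γ' s) (hmem : ∀ u, γ u ∈ S) :
    ∃ c : ℝ, γ' = c • h := by
  have horthogonal := hh.isOutwardNormal.inner_hasDerivAt_eq_zero hγ hmem
  rw [inner_neg_left, o.inner_rightAngleRotation_left, neg_eq_zero] at horthogonal
  exact exists_eq_smul_of_areaForm_eq_zero hh.ne_zero horthogonal

theorem isSmoothConvexBody_of_deriv_ne_zero (hcompact : IsCompact S) (hconvex : Convex ℝ S)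
    (hint : (interior S).Nonempty) (hγ : Differentiable ℝ γ) (hderiv : ∀ s, deriv γ s ≠ 0)
    (hrange : range γ = frontier S) : IsSmoothConvexBody S where
  isCompact := hcompact
  convex := hconvex
  nonempty_interior := hint
  sameRay p hp m n hm hn := by
    obtain ⟨s, rfl⟩ := hrange.symm ▸ hp
    have hmem (u : ℝ) : γ u ∈ S :=
      hcompact.isClosed.frontier_subset (hrange ▸ mem_range_self u)
    have hnormal {k : E} (hk : IsOutwardNormal S (γ s) k) : k ∈ (ℝ ∙ deriv γ s)ᗮ := by
      rw [Submodule.mem_orthogonal_singleton_iff_inner_left]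
      exact hk.inner_hasDerivAt_eq_zero (hγ s).hasDerivAt hmem
    rcases eq_or_ne m 0 with rfl | hm0
    · exact SameRay.zero_left n
    have hline : Module.finrank ℝ (ℝ ∙ deriv γ s)ᗮ = 1 :=
      Submodule.finrank_orthogonal_span_singleton (hderiv s)
    obtain ⟨c, hc⟩ := (finrank_eq_one_iff_of_nonzero' ⟨m, hnormal hm⟩
      (by simpa using hm0)).1 hline ⟨n, hnormal hn⟩
    obtain rfl : c • m = n := congrArg Subtype.val hc
    obtain ⟨x, hx⟩ := hint
    have hmx : 0 < ⟪-m, x - γ s⟫ :=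
      inner_pos_of_mem_interior (neg_ne_zero.2 hm0)
        (fun y hy => by simpa only [inner_neg_left, neg_nonneg] using hm y hy) hx
    have hnx := hn x (interior_subset hx)
    rw [real_inner_smul_left] at hnx
    rw [inner_neg_left, neg_pos] at hmx
    exact SameRay.sameRay_nonneg_smul_right m (nonneg_of_mul_nonpos_left hnx hmx)

end BoundaryCurves

section IncomingRays

variable {E : Type*} [NormedAddCommGroup E] [InnerProductSpace ℝ E]
  [Fact (Module.finrank ℝ E = 2)] {o : Orientation ℝ E (Fin 2)} {S : Set E} {h v w : E} {t : ℝ}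

local notation "ω" => o.areaForm

theorem IsRightTangent.nonneg_of_add_smul_mem (hh : IsRightTangent o S w h) (hv : 0 < ω h v)
    (hmem : w + t • v ∈ S) : 0 ≤ t := by
  have hnonneg := hh.areaForm_nonneg _ hmem
  rw [add_sub_cancel_left, map_smul, smul_eq_mul] at hnonneg
  exact nonneg_of_mul_nonneg_left hnonneg hv

theorem IsRightTangent.hitTime_sub_smul (hh : IsRightTangent o S w h) (hw : w ∈ S) (ht : 0 ≤ t)
    (hv : 0 < ω h v) : hitTime S (w - t • v) v = t := by
  have hmem : w - t • v + t • v ∈ S := by rwa [sub_add_cancel]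
  refine le_antisymm (hitTime_le ht hmem) (le_csInf ⟨t, ht, hmem⟩ fun u ⟨_, hu⟩ => ?_)
  have hu' : w + (u - t) • v ∈ S := by
    convert! hu using 1
    module
  exact sub_nonneg.1 (hh.nonneg_of_add_smul_mem hv hu')

theorem IsRightTangent.sub_smul_notMem (hh : IsRightTangent o S w h) (ht : 0 < t)
    (hv : 0 < ω h v) : w - t • v ∉ S := fun hmem => by
  rw [sub_eq_add_neg, ← neg_smul] at hmem
  exact (neg_nonneg.1 (hh.nonneg_of_add_smul_mem hv hmem)).not_gt ht

end IncomingRays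

section RayCoordinates

variable {S : Set Plane} {γ : ℝ → Plane} {I : Set ℝ}

/-- The differentiable curve `γ` in the boundary of `S` passes through every boundary point exactly
once for a parameter in `I`. -/
structure IsBoundaryParametrization (S : Set Plane) (γ : ℝ → Plane) (I : Set ℝ) : Prop where
  differentiable : Differentiable ℝ γ
  measurableSet : MeasurableSet I
  injOn : InjOn γ I
  mem_frontier : ∀ s, γ s ∈ frontier S
  surjOn : SurjOn γ I (frontier S)

/-- The point from which a ray in the direction `v` arrives at `γ (x 0)` after time `x 1`. -/
noncomputable def rayPoint (γ : ℝ → Plane) (v x : Plane) : Plane := γ (x 0) - x 1 • v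

/-- Coordinates `(s, t, v)` on the set of rays, the pair `(s, t)` being encoded as a point of the
plane: the ray in the direction `v` that arrives at `γ s` after time `t`. -/
noncomputable def rayMap (γ : ℝ → Plane) (z : Plane × UnitVec) : Plane × UnitVec :=
  (rayPoint γ z.2 z.1, z.2)

/-- The coordinates `(s, t, v)` of the rays which start outside `S` and enter `S` transversally at
the end of time `t`. -/
def incomingRays (S : Set Plane) (γ : ℝ → Plane) (I : Set ℝ) : Set (Plane × UnitVec) :=
  {z | z.1 0 ∈ I ∧ 0 < z.1 1 ∧
    0 < planeOrientation.areaForm (rightTangent planeOrientation S (γ (z.1 0))) z.2}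

/-- The density of `dA ⊗ dθ` with respect to `ds dt dθ` in the coordinates given by `rayMap`. -/
noncomputable def rayDensity (S : Set Plane) (γ : ℝ → Plane) (I : Set ℝ) :
    Plane × UnitVec → ENNReal :=
  (incomingRays S γ I).indicator fun z =>
    ENNReal.ofReal |planeOrientation.areaForm (deriv γ (z.1 0)) z.2|

/-- The measure `dA ⊗ dθ` on the visibility domain in the coordinates given by `rayMap`. -/
noncomputable def rayMeasure (S : Set Plane) (γ : ℝ → Plane) (I : Set ℝ) :
    Measure (Plane × UnitVec) :=
  phaseMeasure.withDensity (rayDensity S γ I)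

/-- The bounce in the coordinates given by `rayMap`: the direction is reflected in the normal line
at the bounce point. -/
noncomputable def rayFlip (S : Set Plane) (γ : ℝ → Plane) : Plane × UnitVec → Plane × UnitVec :=
  fiberReflection fun x => rightTangent planeOrientation S (γ (x 0))

theorem hasFDerivAt_rayPoint (hγ : Differentiable ℝ γ) (v x : Plane) :
    HasFDerivAt (rayPoint γ v)
      ((EuclideanSpace.proj 0 : Plane →L[ℝ] ℝ).smulRight (deriv γ (x 0))
        - (EuclideanSpace.proj 1 : Plane →L[ℝ] ℝ).smulRight v) x := by
  have hcoord (i : Fin 2) : HasFDerivAt (fun y : Plane => y i)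
      (EuclideanSpace.proj i : Plane →L[ℝ] ℝ) x :=
    (EuclideanSpace.proj i : Plane →L[ℝ] ℝ).hasFDerivAt
  refine (((hγ (x 0)).hasDerivAt.hasFDerivAt.comp x (hcoord 0)).sub
    ((hcoord 1).smul_const v)).congr_fderiv ?_
  ext y i
  simp

theorem det_proj_smulRight_sub_proj_smulRight (u v : Plane) :
    ((EuclideanSpace.proj 0 : Plane →L[ℝ] ℝ).smulRight u
      - (EuclideanSpace.proj 1 : Plane →L[ℝ] ℝ).smulRight v).det
      = -planeOrientation.areaForm u v := by
  rw [ContinuousLinearMap.det, ← LinearMap.det_toMatrix (EuclideanSpace.basisFun (Fin 2) ℝ).toBasis,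
    Matrix.det_fin_two, areaForm_planeOrientation]
  simp [LinearMap.toMatrix_apply]
  ring

theorem preimage_rayFlip_incomingRays :
    rayFlip S γ ⁻¹' incomingRays S γ I = incomingRays S γ I := by
  ext z
  simp only [mem_preimage, incomingRays, rayFlip, fiberReflection, mem_ofPred_eq, coe_unitMap,
    areaForm_normalReflection]

namespace IsSmoothConvexBody

variable (hS : IsSmoothConvexBody S) (hγ : IsBoundaryParametrization S γ I)
include hS hγ

theorem hitTime_rayPoint {z : Plane × UnitVec} (hz : z ∈ incomingRays S γ I) :
    hitTime S (rayPoint γ z.2 z.1) z.2 = z.1 1 :=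
  have hs := hγ.mem_frontier (z.1 0)
  (hS.isRightTangent_rightTangent planeOrientation hs.2).hitTime_sub_smul
    (hS.isCompact.isClosed.frontier_subset hs) hz.2.1.le hz.2.2

theorem bouncePoint_rayPoint {z : Plane × UnitVec} (hz : z ∈ incomingRays S γ I) :
    bouncePoint S (rayPoint γ z.2 z.1) z.2 = γ (z.1 0) := by
  rw [bouncePoint_eq_add_hitTime_smul, hS.hitTime_rayPoint hγ hz, rayPoint, sub_add_cancel]

theorem bounceMap_rayMap {z : Plane × UnitVec} (hz : z ∈ incomingRays S γ I) :
    bounceMap S (rayMap γ z) = rayMap γ (rayFlip S γ z) := by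
  simp only [bounceMap, rayMap, hS.hitTime_rayPoint hγ hz, hS.bouncePoint_rayPoint hγ hz]
  rfl

theorem injOn_rayPoint (v : UnitVec) :
    InjOn (rayPoint γ v) {x | (x, v) ∈ incomingRays S γ I} := by
  intro x hx y hy hxy
  have htime : x 1 = y 1 := by
    rw [← hS.hitTime_rayPoint hγ hx, ← hS.hitTime_rayPoint hγ hy]
    exact congrArg (hitTime S · v) hxy
  have hpoint : γ (x 0) = γ (y 0) := by
    rw [← hS.bouncePoint_rayPoint hγ hx, ← hS.bouncePoint_rayPoint hγ hy]
    exact congrArg (bouncePoint S · v) hxy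
  ext i
  fin_cases i
  exacts [hγ.injOn hx.1 hy.1 hpoint, htime]

theorem rayMap_mem_visibilityDomain {z : Plane × UnitVec} (hz : z ∈ incomingRays S γ I) :
    rayMap γ z ∈ visibilityDomain S := by
  have hs := hγ.mem_frontier (z.1 0)
  have hh := hS.isRightTangent_rightTangent planeOrientation hs.2
  refine ⟨fun hp => hh.sub_smul_notMem hz.2.1 hz.2.2 (interior_subset hp), z.1 1, hz.2.1.le, ?_⟩
  simpa only [rayMap, rayPoint, sub_add_cancel] using hS.isCompact.isClosed.frontier_subset hs

theorem mem_image_rayPoint {p : Plane} {v : UnitVec} (hp : p ∉ S)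
    (hmeets : ∃ t : ℝ, 0 ≤ t ∧ p + t • (v : Plane) ∈ S)
    (hline : ∃ t : ℝ, p + t • (v : Plane) ∈ interior S) :
    p ∈ rayPoint γ v '' {x | (x, v) ∈ incomingRays S γ I} := by
  have hw : p + hitTime S p v • (v : Plane) ∈ frontier S :=
    hS.bouncePoint_mem_frontier (z := (p, v)) ⟨fun hint => hp (interior_subset hint), hmeets⟩
  obtain ⟨s, hs, hsw⟩ := hγ.surjOn hw
  have hh := hS.isRightTangent_rightTangent planeOrientation hw.2
  have hnonneg := hS.hitTime_mul_areaForm_nonneg (norm_eq_of_mem_sphere v) hmeets hh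
  rw [← hsw] at hh hnonneg
  have htime : 0 < hitTime S p v := by
    refine (hitTime_nonneg S p v).lt_of_ne' fun h0 => hp ?_
    simpa [h0] using hS.isCompact.isClosed.frontier_subset hw
  obtain ⟨t, ht⟩ := hline
  have htransversal := hh.areaForm_pos ht
  rw [hsw, add_sub_add_left_eq_sub, ← sub_smul, map_smul, smul_eq_mul, ← hsw] at htransversal
  refine ⟨!₂[s, hitTime S p v], ⟨hs, htime, ?_⟩, ?_⟩
  · exact (nonneg_of_mul_nonneg_right hnonneg htime).lt_of_ne'
      (right_ne_zero_of_mul htransversal.ne')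
  · simp [rayPoint, hsw]

theorem image_rayPoint_ae_eq (v : UnitVec) :
    rayPoint γ v '' {x | (x, v) ∈ incomingRays S γ I}
      =ᵐ[volume] {p | (p, v) ∈ visibilityDomain S} := by
  refine Filter.EventuallyLE.antisymm (LE.le.eventuallyLE ?_) (ae_le_set.2 ?_)
  · rintro _ ⟨x, hx, rfl⟩
    exact hS.rayMap_mem_visibilityDomain hγ hx
  refine measure_mono_null ?_ (measure_union_null (hS.convex.addHaar_frontier volume)
    (measure_meets_line_disjoint_interior_eq_zero volume hS.convex hS.nonempty_interior v))
  rintro p ⟨hp, himage⟩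
  by_cases hpS : p ∈ S
  · exact .inl ⟨subset_closure hpS, hp.1⟩
  · refine .inr ⟨hp.2.imp fun _ => And.right, ?_⟩
    by_contra! hline
    exact himage (hS.mem_image_rayPoint hγ hpS hp.2 hline)

theorem measurableSet_incomingRays : MeasurableSet (incomingRays S γ I) := by
  have hcoord (i : Fin 2) : Measurable fun z : Plane × UnitVec => z.1 i := by fun_prop
  have htangent : Measurable fun z : Plane × UnitVec =>
      rightTangent planeOrientation S (γ (z.1 0)) :=
    (hS.measurable_rightTangent _).comp (hγ.differentiable.continuous.measurable.comp (hcoord 0))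
  exact (hγ.measurableSet.preimage (hcoord 0)).inter ((measurableSet_lt measurable_const
    (hcoord 1)).inter (measurableSet_lt measurable_const (continuous_areaForm.measurable.comp
      (htangent.prodMk (measurable_subtype_coe.comp measurable_snd)))))

theorem measurable_rayDensity : Measurable (rayDensity S γ I) := by
  have hcoord : Measurable fun z : Plane × UnitVec => z.1 0 := by fun_prop
  have hderiv : Measurable fun z : Plane × UnitVec => deriv γ (z.1 0) :=
    (measurable_deriv γ).comp hcoord
  exact ((continuous_areaForm.measurable.comp (hderiv.prodMk
    (measurable_subtype_coe.comp measurable_snd))).abs.ennreal_ofReal).indicator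
      (hS.measurableSet_incomingRays hγ)

theorem measurePreserving_rayPoint (v : UnitVec) :
    MeasurePreserving (rayPoint γ v) (volume.withDensity fun x => rayDensity S γ I (x, v))
      (volume.restrict {p | (p, v) ∈ visibilityDomain S}) := by
  have hslice : MeasurableSet {x | (x, v) ∈ incomingRays S γ I} :=
    (hS.measurableSet_incomingRays hγ).preimage measurable_prodMk_right
  have hderiv := hasFDerivAt_rayPoint hγ.differentiable v
  refine ⟨(continuous_iff_continuousAt.2 fun x => (hderiv x).continuousAt).measurable, ?_⟩
  have hchange := map_withDensity_abs_det_fderiv_eq_addHaar volume hslice.nullMeasurableSet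
    (fun x _ => (hderiv x).hasFDerivWithinAt) (hS.injOn_rayPoint hγ v)
  simp only [det_proj_smulRight_sub_proj_smulRight, abs_neg] at hchange
  rwa [← withDensity_indicator hslice,
    Measure.restrict_congr_set (hS.image_rayPoint_ae_eq hγ v)] at hchange

theorem measurePreserving_rayMap :
    MeasurePreserving (rayMap γ) (rayMeasure S γ I)
      (phaseMeasure.restrict (visibilityDomain S)) := by
  have hcont := hγ.differentiable.continuous
  have hmeas : Measurable (rayMap γ) := by
    refine Measurable.prodMk ?_ measurable_snd
    unfold rayPoint
    fun_prop
  exact measurePreserving_prodMk_of_forall hmeas (hS.measurable_rayDensity hγ)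
    (measurableSet_visibilityDomain hS.isCompact.isClosed) (hS.measurePreserving_rayPoint hγ)

theorem rayDensity_comp_rayFlip : rayDensity S γ I ∘ rayFlip S γ = rayDensity S γ I := by
  have hjacobian (z : Plane × UnitVec) :
      planeOrientation.areaForm (deriv γ (z.1 0)) (rayFlip S γ z).2
        = planeOrientation.areaForm (deriv γ (z.1 0)) z.2 := by
    obtain ⟨c, hc⟩ := (hS.isRightTangent_rightTangent planeOrientation
      (hγ.mem_frontier (z.1 0)).2).exists_hasDerivAt_eq_smul (hγ.differentiable _).hasDerivAt
        fun u => hS.isCompact.isClosed.frontier_subset (hγ.mem_frontier u)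
    rw [hc, map_smul, LinearMap.smul_apply, LinearMap.smul_apply]
    exact congrArg (c • ·) (areaForm_normalReflection _ _)
  funext z
  rw [rayDensity, comp_apply, ← indicator_comp_right, preimage_rayFlip_incomingRays]
  exact congrArg (indicator _ · z) (funext fun y => congrArg (ENNReal.ofReal |·|) (hjacobian y))

theorem measurePreserving_rayFlip :
    MeasurePreserving (rayFlip S γ) (rayMeasure S γ I) (rayMeasure S γ I) := by
  have hcoord : Measurable fun x : Plane => x 0 := by fun_prop
  have hflip : MeasurePreserving (rayFlip S γ) phaseMeasure phaseMeasure :=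
    measurePreserving_fiberReflection ((hS.measurable_rightTangent planeOrientation).comp
      (hγ.differentiable.continuous.measurable.comp hcoord))
  have hdensity := measurePreserving_withDensity_comp hflip (hS.measurable_rayDensity hγ)
  rwa [hS.rayDensity_comp_rayFlip hγ] at hdensity

theorem measurePreserving_bounceMap :
    MeasurePreserving (bounceMap S) (phaseMeasure.restrict (visibilityDomain S))
      (phaseMeasure.restrict (visibilityDomain S)) := by
  refine measurePreserving_of_ae_semiconj (hS.measurePreserving_rayMap hγ)
    (hS.measurePreserving_rayFlip hγ) hS.measurable_bounceMap ?_
  refine (ae_withDensity_iff (hS.measurable_rayDensity hγ)).2 (.of_forall fun z hz => ?_)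
  exact (hS.bounceMap_rayMap hγ (mem_of_indicator_ne_zero hz)).symm

end IsSmoothConvexBody

end RayCoordinates

theorem mainTheorem5_general {S : Set Plane} {γ : ℝ → Plane} {I : Set ℝ}
    (hS : IsSmoothConvexBody S) (hγ : IsBoundaryParametrization S γ I) :
    ∃ hF : MapsTo (bouncingOuterBilliard S) (visibilityDomain S) (visibilityDomain S),
      visibilityMeasure S univ = ⊤ ∧
      MeasurePreserving
        (hF.restrict (bouncingOuterBilliard S) (visibilityDomain S) (visibilityDomain S))
        (visibilityMeasure S) (visibilityMeasure S) := by
  have hV := measurableSet_visibilityDomain hS.isCompact.isClosed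
  have heq := hS.eqOn_bouncingOuterBilliard
  have hF := (hS.mapsTo_bisectorMap.comp hS.mapsTo_bounceMap).congr heq
  have hinvariant :=
    hS.measurePreserving_bisectorMap_restrict.comp (hS.measurePreserving_bounceMap hγ)
  refine ⟨hF, ?_, measurePreserving_mapsTo_restrict hV hinvariant heq hF⟩
  rw [visibilityMeasure, (MeasurableEmbedding.subtype_coe hV).comap_apply, image_univ,
    Subtype.range_coe, phaseMeasure_visibilityDomain hS.isCompact hS.nonempty_interior]

theorem isBoundaryParametrization_of_periodic {S : Set Plane} {γ : ℝ → Plane} {L : ℝ} (hL : 0 < L)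
    (hγ : Differentiable ℝ γ) (hper : Periodic γ L) (hinj : InjOn γ (Ico 0 L))
    (hrange : range γ = frontier S) : IsBoundaryParametrization S γ (Ico 0 L) where
  differentiable := hγ
  measurableSet := measurableSet_Ico
  injOn := hinj
  mem_frontier s := hrange ▸ mem_range_self s
  surjOn p hp := by
    obtain ⟨s, rfl⟩ := hrange.symm ▸ hp
    obtain ⟨t, ht, hst⟩ := hper.exists_mem_Ico₀ hL s
    exact ⟨t, ht, hst.symm⟩

theorem mainTheorem5 (S : Set Plane) (hcompact : IsCompact S) (hconvex : Convex ℝ S)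
    (hinterior : (interior S).Nonempty) (hboundary : IsSimpleClosedC2Curve (frontier S)) :
    ∃ hF : MapsTo (bouncingOuterBilliard S) (visibilityDomain S) (visibilityDomain S),
      visibilityMeasure S univ = ⊤ ∧
      MeasurePreserving
        (hF.restrict (bouncingOuterBilliard S) (visibilityDomain S) (visibilityDomain S))
        (visibilityMeasure S) (visibilityMeasure S) := by
  obtain ⟨γ, L, hL, hγ, hper, hinj, hderiv, hrange⟩ := hboundary
  have hdiff : Differentiable ℝ γ := hγ.differentiable two_ne_zero
  exact mainTheorem5_general
    (isSmoothConvexBody_of_deriv_ne_zero hcompact hconvex hinterior hdiff hderiv hrange)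
    (isBoundaryParametrization_of_periodic hL hdiff hper hinj hrange)
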